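/- Let $n, d, M$ be integers with $d\ge n$, let $\mathbf Y\in\mathbb R^{n\times M}$ have columns $\mathbf y_1,\dots,\mathbf y_M$ (the targets), let $\lambda_{\mathbf H},\lambda_{\mathbf W}\ge 0$, and put $c:=\lambda_{\mathbf H}\lambda_{\mathbf W}$. For $\mathbf H\in\mathbb R^{d\times M}$, $\mathbf W\in\mathbb R^{n\times d}$, $\mathbf b\in\mathbb R^n$ define the UFM loss and the training MSE by $$\mathcal L(\mathbf H,\mathbf W,\mathbf b)=\frac1{2M}\|\mathbf W\mathbf H+\mathbf b\mathbf 1_M^T-\mathbf Y\|_F^2+\frac{\lambda_{\mathbf H}}{2M}\|\mathbf H\|_F^2+\frac{\lambda_{\mathbf W}}2\|\mathbf W\|_F^2,\qquad \mathrm{MSE}(\mathbf H,\mathbf W,\mathbf b)=\frac1M\|\mathbf W\mathbf H+\mathbf b\mathbf 1_M^T-\mathbf Y\|_F^2 .$$ Let $\bar{\mathbf y}=M^{-1}\sum_i\mathbf y_i$, $\bar{\mathbf Y}=[\bar{\mathbf y}\cdots\bar{\mathbf y}]$, and let $\boldsymbol\Sigma=M^{-1}(\mathbf Y-\bar{\mathbf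 Y})(\mathbf Y-\bar{\mathbf Y})^T$ be the sample covariance matrix of the targets. Assume that $\boldsymbol\Sigma$ has full rank $n$. Let $\lambda_1\ge\dots\ge\lambda_n>0$ be its eigenvalues with multiplicity, let $\boldsymbol\Sigma^{1/2}$ be its positive definite square root, and let $j^*:=\max\{j:\lambda_j\ge c\}$, with $j^*=0$ if this set is empty. For a matrix $\mathbf C$ let $[\mathbf C]_j$ be the matrix obtained from $\mathbf C$ by replacing all columns after the first $j$ by $\mathbf 0$. Suppose that $(\mathbf H^*,\mathbf W^*,\mathbf b^*)$ is a global minimizer of $\mathcal L$. Then $$\mathrm{MSE}(\mathbf H^*,\mathbf W^*,\mathbf b^*)=j^*c+\sum_{i=j^*+1}^n\lambda_i$$ and $$\mathcal L(\mathbf H^*,\mathbf W^*,\mathbf b^*)=\tfrac12\,\mathrm{MSE}(\mathbf H^*,\mathbf W^*,\mathbf b^*)+\sqrt c\sum_{i=1}^n\eta_i ,$$ where $\eta_i$ is the $i$-th diagonal entry of $[\mathbf U^T(\boldsymbol\Sigma^{1/2}-\sqrt c\,\mathbf I_n)\mathbf U]_{j^*}$ for any orthogonal $\mathbf U$ with $\boldsymbol\Sigma=\mathbf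 U\,\mathrm{diag}(\lambda_1,\dots,\lambda_n)\,\mathbf U^T$; that is, $\boldsymbol\Sigma^{1/2}-\sqrt c\,\mathbf I_n$ is written in an orthonormal eigenbasis ordered by decreasing eigenvalue. If $n=1$ and $\sigma^2$ denotes the variance $M^{-1}\sum_i(y_i-\bar y)^2$ of the targets, then $$\mathrm{MSE}(\mathbf H^*,\mathbf W^*,\mathbf b^*)=\begin{cases}c,&c\le\sigma^2,\\ \sigma^2,&c>\sigma^2.\end{cases}$$ -/

import Mathlib

/-- The matrix of column means: every column of it is the mean of the columns of `Y`. -/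
noncomputable def columnMean {n M : ℕ} (Y : Matrix (Fin n) (Fin M) ℝ) :
    Matrix (Fin n) (Fin M) ℝ :=
  Matrix.of fun i _ => (M : ℝ)⁻¹ * ∑ k, Y i k

/-- The sample covariance matrix `M⁻¹ (Y - Ȳ)(Y - Ȳ)ᵀ` of the targets (the columns of `Y`). -/
noncomputable def targetCov {n M : ℕ} (Y : Matrix (Fin n) (Fin M) ℝ) :
    Matrix (Fin n) (Fin n) ℝ :=
  (M : ℝ)⁻¹ • ((Y - columnMean Y) * (Y - columnMean Y).transpose)

/-- The sample variance of the `i`-th coordinate of the targets. -/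
noncomputable def targetVariance {n M : ℕ} (Y : Matrix (Fin n) (Fin M) ℝ) (i : Fin n) : ℝ :=
  (M : ℝ)⁻¹ * ∑ k, (Y i k - (M : ℝ)⁻¹ * ∑ l, Y i l) ^ 2

section Loss

attribute [local instance] Matrix.frobeniusNormedAddCommGroup

/-- The training MSE `M⁻¹ ‖W H + b 1ᵀ - Y‖_F²`. -/
noncomputable def trainingMSE {n d M : ℕ} (Y : Matrix (Fin n) (Fin M) ℝ)
    (H : Matrix (Fin d) (Fin M) ℝ) (W : Matrix (Fin n) (Fin d) ℝ) (b : Fin n → ℝ) : ℝ :=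
  1 / (M : ℝ) * ‖W * H + Matrix.vecMulVec b (fun _ => (1 : ℝ)) - Y‖ ^ 2

/-- The unconstrained feature model loss
`1/(2M) ‖W H + b 1ᵀ - Y‖_F² + lamH/(2M) ‖H‖_F² + lamW/2 ‖W‖_F²`. -/
noncomputable def ufmLoss {n d M : ℕ} (lamH lamW : ℝ) (Y : Matrix (Fin n) (Fin M) ℝ)
    (H : Matrix (Fin d) (Fin M) ℝ) (W : Matrix (Fin n) (Fin d) ℝ) (b : Fin n → ℝ) : ℝ :=
  1 / (2 * (M : ℝ)) * ‖W * H + Matrix.vecMulVec b (fun _ => (1 : ℝ)) - Y‖ ^ 2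
    + lamH / (2 * (M : ℝ)) * ‖H‖ ^ 2 + lamW / 2 * ‖W‖ ^ 2

end Loss

theorem targetCov_isHermitian {n M : ℕ} (Y : Matrix (Fin n) (Fin M) ℝ) :
    (targetCov Y).IsHermitian := by
  ext i j
  simp [targetCov, Matrix.mul_apply, mul_comm]

theorem targetCov_posSemidef {n M : ℕ} (Y : Matrix (Fin n) (Fin M) ℝ) :
    (targetCov Y).PosSemidef := by
  unfold targetCov
  refine Matrix.PosSemidef.smul ?_ (by positivity)
  simpa using Matrix.posSemidef_self_mul_conjTranspose (Y - columnMean Y)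

/-- The eigenvalues of the sample covariance, with multiplicity, in decreasing order
(`covEigenvalue Y i` is the `(i + 1)`-st largest one). -/
noncomputable def covEigenvalue {n M : ℕ} (Y : Matrix (Fin n) (Fin M) ℝ) (i : Fin n) : ℝ :=
  (targetCov_isHermitian Y).eigenvalues₀ (Fin.cast (Fintype.card_fin n).symm i)

theorem covEigenvalue_antitone {n M : ℕ} (Y : Matrix (Fin n) (Fin M) ℝ) :
    Antitone (covEigenvalue Y) := fun _ _ hij =>
  (targetCov_isHermitian Y).eigenvalues₀_antitone hij

/-- The largest `j` in `{1, …, n}` for which the `j`-th entry of `lam` is at least `c`,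
and `0` if there is none. (The `j`-th entry is `lam i` with `j = i + 1`.) -/
noncomputable def jStar {n : ℕ} (c : ℝ) (lam : Fin n → ℝ) : ℕ :=
  (Finset.univ.filter fun i : Fin n => c ≤ lam i).sup fun i => (i : ℕ) + 1

/-- The matrix `[C]_j`: the first `j` columns of `C` are kept, the others are set to zero. -/
def firstColumns {p q : ℕ} (j : ℕ) (C : Matrix (Fin p) (Fin q) ℝ) :
    Matrix (Fin p) (Fin q) ℝ :=
  Matrix.of fun i k => if (k : ℕ) < j then C i k else 0

section Root

open scoped MatrixOrder

/-- The positive semidefinite square root of the sample covariance. -/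
noncomputable def covSqrt {n M : ℕ} (Y : Matrix (Fin n) (Fin M) ℝ) :
    Matrix (Fin n) (Fin n) ℝ :=
  CFC.sqrt (targetCov Y)

theorem covSqrt_posSemidef {n M : ℕ} (Y : Matrix (Fin n) (Fin M) ℝ) :
    (covSqrt Y).PosSemidef :=
  Matrix.nonneg_iff_posSemidef.mp (CFC.sqrt_nonneg _)

theorem covSqrt_mul_self {n M : ℕ} (Y : Matrix (Fin n) (Fin M) ℝ) :
    covSqrt Y * covSqrt Y = targetCov Y :=
  CFC.sqrt_mul_sqrt_self _ (targetCov_posSemidef Y).nonneg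

end Root

/-- The columns of the orthogonal matrix `U` are eigenvectors of the sample covariance, the
`i`-th one belonging to the `i`-th largest eigenvalue. -/
def IsOrderedEigenbasis {n M : ℕ} (Y : Matrix (Fin n) (Fin M) ℝ)
    (U : Matrix (Fin n) (Fin n) ℝ) : Prop :=
  U ∈ Matrix.orthogonalGroup (Fin n) ℝ ∧
    targetCov Y = U * Matrix.diagonal (covEigenvalue Y) * U.transpose

theorem exists_isOrderedEigenbasis {n M : ℕ} (Y : Matrix (Fin n) (Fin M) ℝ) :
    ∃ U : Matrix (Fin n) (Fin n) ℝ, IsOrderedEigenbasis Y U := by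
  have hA := targetCov_isHermitian Y
  let e₀ : Fin (Fintype.card (Fin n)) ≃ Fin n :=
    Fintype.equivOfCardEq (Fintype.card_fin _)
  let e : Fin n ≃ Fin n := (finCongr (Fintype.card_fin n).symm).trans e₀
  let V : Matrix (Fin n) (Fin n) ℝ := hA.eigenvectorUnitary
  have hV : V * V.transpose = 1 := by
    have := (Matrix.mem_unitaryGroup_iff).1 hA.eigenvectorUnitary.2
    simpa [Matrix.star_eq_conjTranspose] using this
  have he : covEigenvalue Y = hA.eigenvalues ∘ e := by
    funext i
    simp [covEigenvalue, Matrix.IsHermitian.eigenvalues, e, e₀]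
  refine ⟨V.submatrix id e, ?_, ?_⟩
  · rw [Matrix.mem_orthogonalGroup_iff, Matrix.transpose_submatrix,
      Matrix.submatrix_mul_equiv, hV]
    simp
  · have hs := hA.spectral_theorem
    rw [Unitary.conjStarAlgAut_apply] at hs
    have hd : Matrix.diagonal (covEigenvalue Y)
        = (Matrix.diagonal hA.eigenvalues).submatrix e e := by
      rw [he, Matrix.submatrix_diagonal_equiv]
    rw [hd, Matrix.transpose_submatrix, Matrix.submatrix_mul_equiv, Matrix.submatrix_mul_equiv]
    simpa [V, Matrix.star_eq_conjTranspose] using hs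

open Matrix in
attribute [local instance] Matrix.frobeniusNormedAddCommGroup in
theorem frobenius_norm_sq_eq_trace {m n : ℕ} (A : Matrix (Fin m) (Fin n) ℝ) :
    ‖A‖ ^ 2 = (A * Aᵀ).trace := by
  have h : 0 ≤ ∑ i, ∑ j, ‖A i j‖ ^ (2 : ℝ) := by positivity
  rw [frobenius_norm_def, ← Real.rpow_natCast, ← Real.rpow_mul h]
  simp [trace, Matrix.mul_apply, pow_two]

open scoped MatrixOrder in
theorem sqrt_targetCov_unique {n M : ℕ} {Y : Matrix (Fin n) (Fin M) ℝ}
    {B : Matrix (Fin n) (Fin n) ℝ} (hB : B.PosSemidef) (h : targetCov Y = B * B) :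
    covSqrt Y = B :=
  CFC.sqrt_unique h.symm hB.nonneg

open Matrix in
theorem trainingMSE_eq_trace {n d M : ℕ} (Y : Matrix (Fin n) (Fin M) ℝ)
    (H : Matrix (Fin d) (Fin M) ℝ) (W : Matrix (Fin n) (Fin d) ℝ) (b : Fin n → ℝ) :
    trainingMSE Y H W b = 1 / (M : ℝ) *
      ((W * H + vecMulVec b (fun _ => (1 : ℝ)) - Y) *
        (W * H + vecMulVec b (fun _ => (1 : ℝ)) - Y)ᵀ).trace := by
  rw [trainingMSE, frobenius_norm_sq_eq_trace]

open Matrix in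
theorem ufmLoss_eq_trace {n d M : ℕ} (lamH lamW : ℝ) (Y : Matrix (Fin n) (Fin M) ℝ)
    (H : Matrix (Fin d) (Fin M) ℝ) (W : Matrix (Fin n) (Fin d) ℝ) (b : Fin n → ℝ) :
    ufmLoss lamH lamW Y H W b = 1 / (2 * (M : ℝ)) *
      ((W * H + vecMulVec b (fun _ => (1 : ℝ)) - Y) *
        (W * H + vecMulVec b (fun _ => (1 : ℝ)) - Y)ᵀ).trace
      + lamH / (2 * (M : ℝ)) * (H * Hᵀ).trace + lamW / 2 * (W * Wᵀ).trace := by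
  rw [ufmLoss, frobenius_norm_sq_eq_trace, frobenius_norm_sq_eq_trace,
    frobenius_norm_sq_eq_trace]

open Matrix in
theorem trace_mul_transpose_nonneg {m n : ℕ} (A : Matrix (Fin m) (Fin n) ℝ) :
    0 ≤ (A * Aᵀ).trace := by
  rw [← frobenius_norm_sq_eq_trace]
  positivity

open Matrix in
theorem eq_zero_of_trace_mul_transpose_nonpos {m n : ℕ} (A : Matrix (Fin m) (Fin n) ℝ)
    (h : (A * Aᵀ).trace ≤ 0) : A = 0 := by
  have h0 := le_antisymm h (trace_mul_transpose_nonneg A)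
  exact trace_mul_conjTranspose_self_eq_zero_iff.mp (by simpa using h0)

open Matrix in
/-- A residual `R` of bounded operator norm makes the regularizer dominate the pairing
`⟨R, W H⟩`. -/
theorem regularizer_add_pairing_nonneg {n d M : ℕ} {lamH lamW : ℝ} (hH : 0 ≤ lamH)
    {R : Matrix (Fin n) (Fin M) ℝ}
    (hR : (((M : ℝ) * (lamH * lamW)) • (1 : Matrix (Fin n) (Fin n) ℝ) - R * Rᵀ).PosSemidef)
    (H : Matrix (Fin d) (Fin M) ℝ) (W : Matrix (Fin n) (Fin d) ℝ) (hW : 0 ≤ lamW) :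
    0 ≤ lamH * (H * Hᵀ).trace + 2 * (R * (W * H)ᵀ).trace + M * lamW * (W * Wᵀ).trace := by
  have hop : ((Wᵀ * R) * (Wᵀ * R)ᵀ).trace ≤ M * (lamH * lamW) * (W * Wᵀ).trace := by
    have h := (hR.conjTranspose_mul_mul_same W).trace_nonneg
    have e : Wᴴ * (((M : ℝ) * (lamH * lamW)) • (1 : Matrix (Fin n) (Fin n) ℝ) - R * Rᵀ) * W
        = ((M : ℝ) * (lamH * lamW)) • (Wᵀ * W) - (Wᵀ * R) * (Wᵀ * R)ᵀ := by
      simp [Matrix.mul_sub, Matrix.sub_mul, Matrix.mul_assoc]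
    rw [e, trace_sub, trace_smul, trace_mul_comm Wᵀ W, smul_eq_mul] at h
    linarith
  have hpair : (R * (W * H)ᵀ).trace = ((Wᵀ * R) * Hᵀ).trace := by
    rw [transpose_mul, ← Matrix.mul_assoc, trace_mul_comm, ← Matrix.mul_assoc]
  have hsym : (H * (Wᵀ * R)ᵀ).trace = ((Wᵀ * R) * Hᵀ).trace := by
    rw [← trace_transpose, transpose_mul, transpose_transpose]
  have hWW := trace_mul_transpose_nonneg W
  rw [hpair]
  rcases hH.eq_or_lt with h0 | h0
  · have hz : Wᵀ * R = 0 :=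
      eq_zero_of_trace_mul_transpose_nonpos _ (by rw [← h0] at hop; linarith)
    rw [hz, ← h0]
    simp only [zero_mul, Matrix.zero_mul, trace_zero, mul_zero, add_zero, zero_add]
    positivity
  · have h := trace_mul_transpose_nonneg (lamH • H + Wᵀ * R)
    have e : ((lamH • H + Wᵀ * R) * (lamH • H + Wᵀ * R)ᵀ).trace =
        lamH * (lamH * (H * Hᵀ).trace) + 2 * (lamH * ((Wᵀ * R) * Hᵀ).trace)
          + ((Wᵀ * R) * (Wᵀ * R)ᵀ).trace := by
      rw [transpose_add, Matrix.add_mul, Matrix.mul_add, Matrix.mul_add]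
      simp only [transpose_smul, Matrix.smul_mul, Matrix.mul_smul, trace_add, trace_smul,
        smul_eq_mul, hsym]
      ring
    rw [e] at h
    refine nonneg_of_mul_nonneg_right ?_ h0
    nlinarith

open Matrix in
/-- The dual lower bound on the loss, with the distance of the residual to the certificate. -/
theorem dual_bound_le_ufmLoss {n d M : ℕ} (hM : 0 < M) {lamH lamW : ℝ} (hH : 0 ≤ lamH)
    (hW : 0 ≤ lamW) (Y : Matrix (Fin n) (Fin M) ℝ) {R : Matrix (Fin n) (Fin M) ℝ}
    (hR : (((M : ℝ) * (lamH * lamW)) • (1 : Matrix (Fin n) (Fin n) ℝ) - R * Rᵀ).PosSemidef)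
    (hR1 : R *ᵥ (fun _ => 1) = 0)
    (H : Matrix (Fin d) (Fin M) ℝ) (W : Matrix (Fin n) (Fin d) ℝ) (b : Fin n → ℝ) :
    1 / (2 * (M : ℝ)) * (-(R * Rᵀ).trace - 2 * (R * Yᵀ).trace
        + ((W * H + vecMulVec b (fun _ => (1 : ℝ)) - Y - R) *
          (W * H + vecMulVec b (fun _ => (1 : ℝ)) - Y - R)ᵀ).trace)
      ≤ ufmLoss lamH lamW Y H W b := by
  have hM' : (0 : ℝ) < M := by exact_mod_cast hM
  rw [ufmLoss_eq_trace]
  set N := W * H + vecMulVec b (fun _ => (1 : ℝ)) - Y with hN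
  have hRN : (R * Nᵀ).trace = (R * (W * H)ᵀ).trace - (R * Yᵀ).trace := by
    rw [hN, transpose_sub, transpose_add, Matrix.mul_sub, Matrix.mul_add, transpose_vecMulVec,
      mul_vecMulVec, hR1]
    simp
  have hNR : (N * Rᵀ).trace = (R * Nᵀ).trace := by
    rw [← trace_transpose, transpose_mul, transpose_transpose]
  have e : ((N - R) * (N - R)ᵀ).trace
      = (N * Nᵀ).trace - 2 * (R * Nᵀ).trace + (R * Rᵀ).trace := by
    rw [transpose_sub, Matrix.sub_mul, Matrix.mul_sub, Matrix.mul_sub]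
    simp only [trace_sub, hNR]
    ring
  have h := regularizer_add_pairing_nonneg hH hR H W hW
  rw [e, hRN, ← sub_nonneg]
  have h2 := mul_nonneg (by positivity : 0 ≤ 1 / (2 * (M : ℝ))) h
  refine h2.trans_eq ?_
  field_simp
  ring

open Matrix in
theorem sub_columnMean_mulVec_one {n M : ℕ} (hM : 0 < M) (Y : Matrix (Fin n) (Fin M) ℝ) :
    (Y - columnMean Y) *ᵥ (fun _ => 1) = 0 := by
  have hM' : (M : ℝ) ≠ 0 := by exact_mod_cast hM.ne'
  ext i
  simp [mulVec, dotProduct, columnMean, hM']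

open Matrix in
theorem columnMean_eq_vecMulVec {n M : ℕ} (Y : Matrix (Fin n) (Fin M) ℝ) :
    columnMean Y = vecMulVec (fun i => (M : ℝ)⁻¹ * ∑ k, Y i k) (fun _ => (1 : ℝ)) := by
  ext i k
  simp [columnMean, vecMulVec_apply]

/-- The factor by which an optimal residual shrinks the spectral component of variance `x`. -/
noncomputable def residualFactor (c x : ℝ) : ℝ := if x ≤ c then 1 else √c / √x

theorem residualFactor_sq_mul {c x : ℝ} (hc : 0 ≤ c) :
    residualFactor c x ^ 2 * x = min x c := by
  unfold residualFactor
  split_ifs with h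
  · simp [h]
  · push Not at h
    rw [div_pow, Real.sq_sqrt hc, Real.sq_sqrt (hc.trans h.le), min_eq_right h.le]
    field_simp [(hc.trans_lt h).ne']

theorem residualFactor_mul {c x : ℝ} (hc : 0 ≤ c) :
    residualFactor c x * x = min x c + √c * max (√x - √c) 0 := by
  unfold residualFactor
  split_ifs with h
  · rw [min_eq_left h, max_eq_right (sub_nonpos.mpr (Real.sqrt_le_sqrt h))]
    ring
  · push Not at h
    have hx : 0 < √x := Real.sqrt_pos.mpr (hc.trans_lt h)
    rw [min_eq_right h.le, max_eq_left (sub_nonneg.mpr (Real.sqrt_le_sqrt h.le))]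
    have e : √c / √x * x = √c * √x := by
      nth_rw 2 [← Real.mul_self_sqrt (hc.trans h.le)]
      field_simp
    rw [e, mul_sub, Real.mul_self_sqrt hc]
    ring

theorem one_sub_residualFactor_sq_mul {c x : ℝ} (hc : 0 ≤ c) :
    (1 - residualFactor c x) ^ 2 * x = max (√x - √c) 0 ^ 2 := by
  unfold residualFactor
  split_ifs with h
  · rw [max_eq_right (sub_nonpos.mpr (Real.sqrt_le_sqrt h))]
    ring
  · push Not at h
    have hx : 0 < √x := Real.sqrt_pos.mpr (hc.trans_lt h)
    rw [max_eq_left (sub_nonneg.mpr (Real.sqrt_le_sqrt h.le))]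
    have h2 := Real.sq_sqrt (hc.trans h.le)
    nth_rw 2 [← h2]
    field_simp

theorem residualFactor_eq_one {c x : ℝ} (hc : 0 ≤ c) (h : max (√x - √c) 0 = 0) : residualFactor c x = 1 := by
  have h1 : √x ≤ √c := by simpa using h
  rw [residualFactor, if_pos ((Real.sqrt_le_sqrt_iff hc).mp h1)]

theorem covEigenvalue_nonneg {n M : ℕ} (Y : Matrix (Fin n) (Fin M) ℝ) (i : Fin n) :
    0 ≤ covEigenvalue Y i := by
  have h := (targetCov_posSemidef Y).eigenvalues_nonneg
    (Fintype.equivOfCardEq (Fintype.card_fin _) (Fin.cast (Fintype.card_fin n).symm i))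
  simpa [covEigenvalue, Matrix.IsHermitian.eigenvalues] using h

/-- The residual `-U diag(δ) Uᵀ (Y - Ȳ)` of the minimizers of the loss. -/
noncomputable def optimalResidual {n M : ℕ} (c : ℝ) (Y : Matrix (Fin n) (Fin M) ℝ)
    (U : Matrix (Fin n) (Fin n) ℝ) : Matrix (Fin n) (Fin M) ℝ :=
  -(U * Matrix.diagonal (fun i => residualFactor c (covEigenvalue Y i)) *
    (U.transpose * (Y - columnMean Y)))

section Spectral

open Matrix

variable {n M : ℕ} {Y : Matrix (Fin n) (Fin M) ℝ} {U : Matrix (Fin n) (Fin n) ℝ}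

theorem IsOrderedEigenbasis.transpose_mul_self (hU : IsOrderedEigenbasis Y U) : Uᵀ * U = 1 := by
  simpa [star_eq_conjTranspose] using (mem_orthogonalGroup_iff' _ _).mp hU.1

theorem IsOrderedEigenbasis.mul_transpose_self (hU : IsOrderedEigenbasis Y U) : U * Uᵀ = 1 := by
  simpa [star_eq_conjTranspose] using (mem_orthogonalGroup_iff _ _).mp hU.1

theorem IsOrderedEigenbasis.trace_conj (hU : IsOrderedEigenbasis Y U)
    (A : Matrix (Fin n) (Fin n) ℝ) : (U * A * Uᵀ).trace = A.trace := by
  rw [trace_mul_comm, ← Matrix.mul_assoc, hU.transpose_mul_self, Matrix.one_mul]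

theorem IsOrderedEigenbasis.gram_coordinates (hM : 0 < M) (hU : IsOrderedEigenbasis Y U) :
    (Uᵀ * (Y - columnMean Y)) * (Uᵀ * (Y - columnMean Y))ᵀ
      = (M : ℝ) • diagonal (covEigenvalue Y) := by
  have hM' : (M : ℝ) ≠ 0 := by exact_mod_cast hM.ne'
  have h1 : (Y - columnMean Y) * (Y - columnMean Y)ᵀ = (M : ℝ) • targetCov Y := by
    rw [targetCov, smul_smul, mul_inv_cancel₀ hM', one_smul]
  calc _ = Uᵀ * ((Y - columnMean Y) * (Y - columnMean Y)ᵀ) * U := by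
        rw [transpose_mul, transpose_transpose]; simp only [Matrix.mul_assoc]
    _ = (M : ℝ) • (Uᵀ * U * diagonal (covEigenvalue Y) * (Uᵀ * U)) := by
        rw [h1, hU.2, Matrix.mul_smul, Matrix.smul_mul]; simp only [Matrix.mul_assoc]
    _ = _ := by rw [hU.transpose_mul_self, Matrix.one_mul, Matrix.mul_one]

theorem IsOrderedEigenbasis.gram_diagonal_mul (hM : 0 < M) (hU : IsOrderedEigenbasis Y U)
    (p q : Fin n → ℝ) :
    (diagonal p * (Uᵀ * (Y - columnMean Y))) * (diagonal q * (Uᵀ * (Y - columnMean Y)))ᵀ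
      = diagonal fun i => (M : ℝ) * (p i * q i * covEigenvalue Y i) := by
  rw [transpose_mul (diagonal q), diagonal_transpose, Matrix.mul_assoc,
    ← Matrix.mul_assoc _ _ (diagonal q), hU.gram_coordinates hM, Matrix.smul_mul,
    Matrix.mul_smul, diagonal_mul_diagonal, diagonal_mul_diagonal, ← diagonal_smul]
  congr 1
  ext i
  simp only [Pi.smul_apply, smul_eq_mul]
  ring

theorem optimalResidual_mulVec_one (hM : 0 < M) (c : ℝ) :
    optimalResidual c Y U *ᵥ (fun _ => 1) = 0 := by
  rw [optimalResidual, neg_mulVec, ← mulVec_mulVec, ← mulVec_mulVec,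
    ← mulVec_mulVec, sub_columnMean_mulVec_one hM]
  simp

theorem IsOrderedEigenbasis.optimalResidual_gram (hM : 0 < M) (hU : IsOrderedEigenbasis Y U)
    {c : ℝ} (hc : 0 ≤ c) :
    optimalResidual c Y U * (optimalResidual c Y U)ᵀ
      = U * diagonal (fun i => (M : ℝ) * min (covEigenvalue Y i) c) * Uᵀ := by
  have h := hU.gram_diagonal_mul hM (fun i => residualFactor c (covEigenvalue Y i))
    (fun i => residualFactor c (covEigenvalue Y i))
  simp only [← pow_two, residualFactor_sq_mul hc] at h
  rw [← h, optimalResidual, transpose_neg, Matrix.neg_mul, Matrix.mul_neg, neg_neg, Matrix.mul_assoc U, transpose_mul U]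
  simp only [Matrix.mul_assoc]

theorem IsOrderedEigenbasis.posSemidef_sub_optimalResidual_gram (hM : 0 < M)
    (hU : IsOrderedEigenbasis Y U) {c : ℝ} (hc : 0 ≤ c) :
    (((M : ℝ) * c) • (1 : Matrix (Fin n) (Fin n) ℝ)
      - optimalResidual c Y U * (optimalResidual c Y U)ᵀ).PosSemidef := by
  have e : ((M : ℝ) * c) • (1 : Matrix (Fin n) (Fin n) ℝ)
      - optimalResidual c Y U * (optimalResidual c Y U)ᵀ
      = U * diagonal (fun i => (M : ℝ) * c - (M : ℝ) * min (covEigenvalue Y i) c) * Uᴴ := by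
    rw [hU.optimalResidual_gram hM hc, ← diagonal_sub, Matrix.mul_sub, Matrix.sub_mul,
      conjTranspose_eq_transpose_of_trivial, ← smul_one_eq_diagonal, Matrix.mul_smul,
      Matrix.mul_one, Matrix.smul_mul, hU.mul_transpose_self]
  rw [e]
  refine PosSemidef.mul_mul_conjTranspose_same (PosSemidef.diagonal fun i => ?_) U
  have := mul_le_mul_of_nonneg_left (min_le_right (covEigenvalue Y i) c) (Nat.cast_nonneg M)
  simpa using this

theorem IsOrderedEigenbasis.trace_optimalResidual_gram (hM : 0 < M)
    (hU : IsOrderedEigenbasis Y U) {c : ℝ} (hc : 0 ≤ c) :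
    (optimalResidual c Y U * (optimalResidual c Y U)ᵀ).trace
      = M * ∑ i, min (covEigenvalue Y i) c := by
  rw [hU.optimalResidual_gram hM hc, hU.trace_conj, trace_diagonal, Finset.mul_sum]

theorem IsOrderedEigenbasis.trace_optimalResidual_mul_target (hM : 0 < M)
    (hU : IsOrderedEigenbasis Y U) {c : ℝ} (hc : 0 ≤ c) :
    (optimalResidual c Y U * Yᵀ).trace
      = -(M * (∑ i, min (covEigenvalue Y i) c
          + √c * ∑ i, max (√(covEigenvalue Y i) - √c) 0)) := by
  have hY : Y = U * (Uᵀ * (Y - columnMean Y))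
      + vecMulVec (fun i => (M : ℝ)⁻¹ * ∑ k, Y i k) (fun _ => (1 : ℝ)) := by
    rw [← Matrix.mul_assoc, hU.mul_transpose_self, Matrix.one_mul, ← columnMean_eq_vecMulVec,
      sub_add_cancel]
  have hmean : optimalResidual c Y U * Yᵀ
      = optimalResidual c Y U * (U * (Uᵀ * (Y - columnMean Y)))ᵀ := by
    conv_lhs => rw [hY]
    rw [transpose_add, Matrix.mul_add, transpose_vecMulVec, mul_vecMulVec, ← hY,
      optimalResidual_mulVec_one hM]
    simp
  have h := hU.gram_diagonal_mul hM (fun i => residualFactor c (covEigenvalue Y i)) (fun _ => 1)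
  simp only [diagonal_one, Matrix.one_mul, mul_one, residualFactor_mul hc] at h
  rw [hmean, transpose_mul U, optimalResidual, Matrix.neg_mul, trace_neg, ← Matrix.mul_assoc,
    Matrix.mul_assoc U, Matrix.mul_assoc U, h, hU.trace_conj, trace_diagonal, ← Finset.mul_sum,
    Finset.sum_add_distrib, ← Finset.mul_sum]

/-- The loss comes within `((λ_H / t + λ_W t) / 2 - √c) ∑ (√λ_i - √c)₊` of the dual bound. -/
theorem IsOrderedEigenbasis.exists_ufmLoss_eq (hM : 0 < M) (hU : IsOrderedEigenbasis Y U)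
    {d : ℕ} (hnd : n ≤ d) (lamH lamW : ℝ) {c t : ℝ} (hc : 0 ≤ c) (ht : 0 < t) :
    ∃ (H : Matrix (Fin d) (Fin M) ℝ) (W : Matrix (Fin n) (Fin d) ℝ) (b : Fin n → ℝ),
      ufmLoss lamH lamW Y H W b = 1 / 2 * ∑ i, min (covEigenvalue Y i) c
        + (lamH / t + lamW * t) / 2 * ∑ i, max (√(covEigenvalue Y i) - √c) 0 := by
  have hM' : (M : ℝ) ≠ 0 := by exact_mod_cast hM.ne'
  set g : Fin n → ℝ := fun i => max (√(covEigenvalue Y i) - √c) 0 with hg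
  have hg0 : ∀ i, 0 ≤ g i := fun i => le_max_right _ _
  let a : Fin n → ℝ := fun i => √(t * g i)
  let h : Fin n → ℝ := fun i => (1 - residualFactor c (covEigenvalue Y i)) / a i
  have ha2 : ∀ i, a i * a i = t * g i := fun i => Real.mul_self_sqrt (mul_nonneg ht.le (hg0 i))
  have hah : ∀ i, a i * h i = 1 - residualFactor c (covEigenvalue Y i) := by
    intro i
    rcases (hg0 i).eq_or_lt with h0 | h0
    · simp [a, h, ← h0, residualFactor_eq_one hc h0.symm]
    · have : a i ≠ 0 := (Real.sqrt_pos.mpr (mul_pos ht h0)).ne'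
      simp only [h]
      field_simp
  have hh2 : ∀ i, h i * h i * covEigenvalue Y i = g i / t := by
    intro i
    have e : h i * h i * covEigenvalue Y i
        = (1 - residualFactor c (covEigenvalue Y i)) ^ 2 * covEigenvalue Y i / (a i * a i) := by
      simp only [h]
      ring
    rw [e, one_sub_residualFactor_sq_mul hc, ha2]
    change g i ^ 2 / (t * g i) = g i / t
    rcases (hg0 i).eq_or_lt with h0 | h0
    · simp [← h0]
    · field_simp
  let E : Matrix (Fin n) (Fin d) ℝ := (1 : Matrix (Fin d) (Fin d) ℝ).submatrix (Fin.castLE hnd) id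
  have hE : E * Eᵀ = 1 := by
    simp only [E, transpose_submatrix, transpose_one]
    rw [← submatrix_mul _ _ _ id _ Function.bijective_id, Matrix.one_mul]
    exact submatrix_one _ (Fin.castLE_injective hnd)
  set X := Uᵀ * (Y - columnMean Y) with hX
  refine ⟨Eᵀ * (diagonal h * X), U * diagonal a * E, fun i => (M : ℝ)⁻¹ * ∑ k, Y i k, ?_⟩
  have hres : U * diagonal a * E * (Eᵀ * (diagonal h * X))
      + vecMulVec (fun i => (M : ℝ)⁻¹ * ∑ k, Y i k) (fun _ => (1 : ℝ)) - Y
      = optimalResidual c Y U := by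
    have h1 : U * diagonal a * E * (Eᵀ * (diagonal h * X)) = U * (diagonal a * diagonal h) * X := by
      rw [← Matrix.mul_assoc, Matrix.mul_assoc _ E, hE, Matrix.mul_one]
      simp only [Matrix.mul_assoc]
    have h2 : diagonal a * diagonal h
        = 1 - diagonal fun i => residualFactor c (covEigenvalue Y i) := by
      rw [diagonal_mul_diagonal, ← diagonal_one, diagonal_sub]
      simp only [hah]
    have h3 : U * X = Y - columnMean Y := by
      rw [hX, ← Matrix.mul_assoc, hU.mul_transpose_self, Matrix.one_mul]
    rw [h1, h2, Matrix.mul_sub, Matrix.mul_one, Matrix.sub_mul, h3, ← columnMean_eq_vecMulVec,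
      optimalResidual]
    abel
  have hHH : ((Eᵀ * (diagonal h * X)) * (Eᵀ * (diagonal h * X))ᵀ).trace
      = M * ((∑ i, g i) / t) := by
    rw [transpose_mul Eᵀ, transpose_transpose, ← Matrix.mul_assoc, trace_mul_comm,
      Matrix.mul_assoc Eᵀ, ← Matrix.mul_assoc E, hE, Matrix.one_mul,
      hU.gram_diagonal_mul hM, trace_diagonal]
    simp only [hh2]
    rw [← Finset.mul_sum, Finset.sum_div]
  have hWW : ((U * diagonal a * E) * (U * diagonal a * E)ᵀ).trace = t * ∑ i, g i := by
    have h1 : (U * diagonal a * E) * (U * diagonal a * E)ᵀ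
        = U * (diagonal a * (E * Eᵀ) * diagonal a) * Uᵀ := by
      rw [transpose_mul, transpose_mul, diagonal_transpose]
      simp only [Matrix.mul_assoc]
    rw [h1, hE, Matrix.mul_one, diagonal_mul_diagonal, hU.trace_conj, trace_diagonal,
      Finset.mul_sum]
    simp only [ha2]
  rw [ufmLoss_eq_trace, hres, hHH, hWW, hU.trace_optimalResidual_gram hM hc]
  field_simp
  ring

theorem IsOrderedEigenbasis.conj_covSqrt (hU : IsOrderedEigenbasis Y U) :
    Uᵀ * covSqrt Y * U = diagonal fun i => √(covEigenvalue Y i) := by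
  have h : covSqrt Y = U * (diagonal fun i => √(covEigenvalue Y i)) * Uᵀ := by
    refine sqrt_targetCov_unique ?_ ?_
    · have := PosSemidef.mul_mul_conjTranspose_same
        (PosSemidef.diagonal fun i => Real.sqrt_nonneg (covEigenvalue Y i)) U
      simpa using this
    · have e : diagonal (covEigenvalue Y) = (diagonal fun i => √(covEigenvalue Y i)) * (Uᵀ * U) *
          (diagonal fun i => √(covEigenvalue Y i)) := by
        rw [hU.transpose_mul_self, Matrix.mul_one, diagonal_mul_diagonal]
        simp only [Real.mul_self_sqrt (covEigenvalue_nonneg Y _)]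
      rw [hU.2, e]
      simp only [Matrix.mul_assoc]
  calc _ = (Uᵀ * U) * (diagonal fun i => √(covEigenvalue Y i)) * (Uᵀ * U) := by
        rw [h]; simp only [Matrix.mul_assoc]
    _ = _ := by rw [hU.transpose_mul_self, Matrix.one_mul, Matrix.mul_one]

end Spectral

theorem le_of_forall_le_scaled {lamH lamW L V G : ℝ} (hH : 0 ≤ lamH) (hW : 0 ≤ lamW) (hG : 0 ≤ G)
    (h : ∀ t : ℝ, 0 < t → L ≤ V + (lamH / t + lamW * t) / 2 * G) :
    L ≤ V + √(lamH * lamW) * G := by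
  have key : ∀ e : ℝ, 0 < e → L ≤ V + √((lamH + e) * (lamW + e)) * G := by
    intro e he
    have hp : 0 < lamH + e := by linarith
    have hq : 0 < lamW + e := by linarith
    have hp' := Real.sqrt_pos.mpr hp
    have hq' := Real.sqrt_pos.mpr hq
    have ht : 0 < √(lamH + e) / √(lamW + e) := by positivity
    refine (h _ ht).trans ?_
    have h1 : lamH / (√(lamH + e) / √(lamW + e)) ≤ √(lamH + e) * √(lamW + e) := by
      rw [div_le_iff₀ ht]
      have : √(lamH + e) * √(lamW + e) * (√(lamH + e) / √(lamW + e)) = √(lamH + e) ^ 2 := by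
        field_simp
      rw [this, Real.sq_sqrt hp.le]
      linarith
    have h2 : lamW * (√(lamH + e) / √(lamW + e)) ≤ √(lamH + e) * √(lamW + e) := by
      rw [← mul_div_assoc, div_le_iff₀ hq', mul_assoc, ← pow_two, Real.sq_sqrt hq.le]
      nlinarith
    rw [Real.sqrt_mul hp.le]
    have := mul_le_mul_of_nonneg_right (by linarith :
      (lamH / (√(lamH + e) / √(lamW + e)) + lamW * (√(lamH + e) / √(lamW + e))) / 2
        ≤ √(lamH + e) * √(lamW + e)) hG
    linarith
  have hcont : Continuous fun e : ℝ => V + √((lamH + e) * (lamW + e)) * G := by fun_prop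
  have hlim := (hcont.tendsto 0).mono_left (nhdsWithin_le_nhds (s := Set.Ioi 0))
  simp only [add_zero] at hlim
  exact ge_of_tendsto hlim (eventually_nhdsWithin_of_forall key)

open Matrix in
theorem minimizer_loss_and_mse {n d M : ℕ} (hM : 0 < M) (hnd : n ≤ d) {lamH lamW : ℝ}
    (hH : 0 ≤ lamH) (hW : 0 ≤ lamW) {Y : Matrix (Fin n) (Fin M) ℝ}
    {H : Matrix (Fin d) (Fin M) ℝ} {W : Matrix (Fin n) (Fin d) ℝ} {b : Fin n → ℝ}
    (hmin : ∀ (H' : Matrix (Fin d) (Fin M) ℝ) (W' : Matrix (Fin n) (Fin d) ℝ) (b' : Fin n → ℝ),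
      ufmLoss lamH lamW Y H W b ≤ ufmLoss lamH lamW Y H' W' b') :
    trainingMSE Y H W b = ∑ i, min (covEigenvalue Y i) (lamH * lamW) ∧
    ufmLoss lamH lamW Y H W b = 1 / 2 * trainingMSE Y H W b
      + √(lamH * lamW) * ∑ i, max (√(covEigenvalue Y i) - √(lamH * lamW)) 0 := by
  obtain ⟨U, hU⟩ := exists_isOrderedEigenbasis Y
  have hM' : (0 : ℝ) < M := by exact_mod_cast hM
  have hc := mul_nonneg hH hW
  have hlow := dual_bound_le_ufmLoss hM hH hW Y (hU.posSemidef_sub_optimalResidual_gram hM hc)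
    (optimalResidual_mulVec_one hM _) H W b
  have hup : ufmLoss lamH lamW Y H W b ≤ 1 / 2 * ∑ i, min (covEigenvalue Y i) (lamH * lamW)
      + √(lamH * lamW) * ∑ i, max (√(covEigenvalue Y i) - √(lamH * lamW)) 0 := by
    refine le_of_forall_le_scaled hH hW (Finset.sum_nonneg fun i _ => le_max_right _ _) ?_
    intro t ht
    obtain ⟨H', W', b', h⟩ := hU.exists_ufmLoss_eq hM hnd lamH lamW hc ht
    exact h ▸ hmin H' W' b'
  rw [hU.trace_optimalResidual_gram hM hc, hU.trace_optimalResidual_mul_target hM hc] at hlow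
  set N := W * H + vecMulVec b (fun _ => (1 : ℝ)) - Y with hN
  set R := optimalResidual (lamH * lamW) Y U with hR
  set S := ∑ i, min (covEigenvalue Y i) (lamH * lamW) with hS
  set G := ∑ i, max (√(covEigenvalue Y i) - √(lamH * lamW)) 0 with hG
  have hlow' : 1 / 2 * S + √(lamH * lamW) * G + 1 / (2 * (M : ℝ)) * ((N - R) * (N - R)ᵀ).trace
      ≤ ufmLoss lamH lamW Y H W b := by
    refine le_trans (le_of_eq ?_) hlow
    field_simp
    ring
  have hgap := trace_mul_transpose_nonneg (N - R)
  have hNR : N = R := by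
    refine sub_eq_zero.mp (eq_zero_of_trace_mul_transpose_nonpos _ ?_)
    have : 1 / (2 * (M : ℝ)) * ((N - R) * (N - R)ᵀ).trace ≤ 1 / (2 * (M : ℝ)) * 0 := by linarith
    exact le_of_mul_le_mul_left this (by positivity)
  have hmse : trainingMSE Y H W b = S := by
    rw [trainingMSE_eq_trace, ← hN, hNR, hU.trace_optimalResidual_gram hM hc, ← hS]
    field_simp
  refine ⟨hmse, ?_⟩
  rw [hmse]
  refine le_antisymm hup (le_trans ?_ hlow')
  have := mul_nonneg (by positivity : 0 ≤ 1 / (2 * (M : ℝ))) hgap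
  linarith

theorem lt_jStar_iff {n : ℕ} {c : ℝ} {lam : Fin n → ℝ} (hlam : Antitone lam) (i : Fin n) :
    (i : ℕ) < jStar c lam ↔ c ≤ lam i := by
  simp only [jStar, Finset.lt_sup_iff, Finset.mem_filter, Finset.mem_univ, true_and]
  constructor
  · rintro ⟨k, hk, hik⟩
    exact hk.trans (hlam (Fin.le_def.mpr (Nat.lt_succ_iff.mp hik)))
  · exact fun h => ⟨i, h, Nat.lt_succ_self _⟩

theorem jStar_le {n : ℕ} (c : ℝ) (lam : Fin n → ℝ) : jStar c lam ≤ n :=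
  Finset.sup_le fun i _ => i.isLt

theorem sum_min_eq_jStar {n : ℕ} (c : ℝ) {lam : Fin n → ℝ} (hlam : Antitone lam) :
    ∑ i, min (lam i) c = (jStar c lam : ℝ) * c +
      ∑ i ∈ Finset.univ.filter (fun i : Fin n => jStar c lam ≤ (i : ℕ)), lam i := by
  have hcard : (Finset.univ.filter fun i : Fin n => (i : ℕ) < jStar c lam).card = jStar c lam := by
    rw [Fin.card_filter_val_lt, min_eq_right (jStar_le c lam)]
  rw [← Finset.sum_filter_add_sum_filter_not _ (fun i : Fin n => (i : ℕ) < jStar c lam)]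
  congr 1
  · rw [Finset.sum_congr rfl (g := fun _ => c), Finset.sum_const, hcard, nsmul_eq_mul]
    intro i hi
    exact min_eq_right ((lt_jStar_iff hlam i).mp (Finset.mem_filter.mp hi).2)
  · refine Finset.sum_congr (by simp only [not_lt]) fun i hi => min_eq_left ?_
    have := (lt_jStar_iff (c := c) hlam i).not.mp (not_lt.mpr (Finset.mem_filter.mp hi).2)
    exact (not_le.mp this).le

open Matrix in
theorem sum_firstColumns_diag {n M : ℕ} {Y : Matrix (Fin n) (Fin M) ℝ}
    {U : Matrix (Fin n) (Fin n) ℝ} (hU : IsOrderedEigenbasis Y U) (c : ℝ) :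
    ∑ i : Fin n, firstColumns (jStar c (covEigenvalue Y))
      (Uᵀ * (covSqrt Y - √c • (1 : Matrix (Fin n) (Fin n) ℝ)) * U) i i
      = ∑ i, max (√(covEigenvalue Y i) - √c) 0 := by
  have h : Uᵀ * (covSqrt Y - √c • (1 : Matrix (Fin n) (Fin n) ℝ)) * U
      = (diagonal fun i => √(covEigenvalue Y i)) - √c • 1 := by
    rw [Matrix.mul_sub, Matrix.sub_mul, hU.conj_covSqrt, Matrix.mul_smul, Matrix.mul_one,
      Matrix.smul_mul, hU.transpose_mul_self]
  refine Finset.sum_congr rfl fun i _ => ?_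
  simp only [h, firstColumns, of_apply, lt_jStar_iff (covEigenvalue_antitone Y), Matrix.sub_apply,
    diagonal_apply_eq, Matrix.smul_apply, one_apply_eq, smul_eq_mul, mul_one]
  split_ifs with hi
  · exact (max_eq_left (sub_nonneg.mpr (Real.sqrt_le_sqrt hi))).symm
  · exact (max_eq_right (sub_nonpos.mpr (Real.sqrt_le_sqrt (not_le.mp hi).le))).symm

open Matrix in
theorem covEigenvalue_eq_targetVariance {M : ℕ} (Y : Matrix (Fin 1) (Fin M) ℝ) (i : Fin 1) :
    covEigenvalue Y i = targetVariance Y i := by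
  obtain ⟨U, hU⟩ := exists_isOrderedEigenbasis Y
  have h : (targetCov Y).trace = covEigenvalue Y i := by
    rw [hU.2, hU.trace_conj, trace_diagonal, Fin.sum_univ_one, Subsingleton.elim i 0]
  rw [← h, trace_fin_one, Subsingleton.elim i 0]
  simp [targetCov, targetVariance, columnMean, Matrix.mul_apply, pow_two]

theorem theorem3p1 {n d M : ℕ} (hnd : n ≤ d) (lamH lamW : ℝ) (hH : 0 ≤ lamH) (hW : 0 ≤ lamW)
    (Y : Matrix (Fin n) (Fin M) ℝ) (hY : (targetCov Y).rank = n)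
    (H : Matrix (Fin d) (Fin M) ℝ) (W : Matrix (Fin n) (Fin d) ℝ) (b : Fin n → ℝ)
    (hmin : ∀ (H' : Matrix (Fin d) (Fin M) ℝ) (W' : Matrix (Fin n) (Fin d) ℝ) (b' : Fin n → ℝ),
      ufmLoss lamH lamW Y H W b ≤ ufmLoss lamH lamW Y H' W' b') :
    (∀ U : Matrix (Fin n) (Fin n) ℝ, IsOrderedEigenbasis Y U →
      ufmLoss lamH lamW Y H W b =
        1 / 2 * trainingMSE Y H W b + √(lamH * lamW) *
          ∑ i : Fin n, firstColumns (jStar (lamH * lamW) (covEigenvalue Y))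
            (U.transpose * (covSqrt Y - √(lamH * lamW) • (1 : Matrix (Fin n) (Fin n) ℝ)) * U) i i) ∧
    trainingMSE Y H W b =
      (jStar (lamH * lamW) (covEigenvalue Y) : ℝ) * (lamH * lamW) +
        ∑ i ∈ Finset.univ.filter (fun i : Fin n =>
          jStar (lamH * lamW) (covEigenvalue Y) ≤ (i : ℕ)), covEigenvalue Y i ∧
    (n = 1 → ∀ i : Fin n, trainingMSE Y H W b =
      if lamH * lamW ≤ targetVariance Y i then lamH * lamW else targetVariance Y i) := by
  rcases Nat.eq_zero_or_pos M with rfl | hM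
  · obtain rfl : n = 0 := by
      rw [← hY]
      simp [targetCov]
    refine ⟨fun U _ => ?_, ?_, fun h => absurd h (by norm_num)⟩
    · simp [ufmLoss_eq_trace, trainingMSE_eq_trace, Matrix.trace]
    · simp [trainingMSE_eq_trace, Matrix.trace, jStar]
  obtain ⟨hmse, hloss⟩ := minimizer_loss_and_mse hM hnd hH hW hmin
  refine ⟨fun U hU => ?_, ?_, ?_⟩
  · rw [sum_firstColumns_diag hU, hloss]
  · rw [hmse, sum_min_eq_jStar _ (covEigenvalue_antitone Y)]
  · rintro rfl i
    rw [hmse, Fin.sum_univ_one, Subsingleton.elim i 0, covEigenvalue_eq_targetVariance,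
      min_def]
    split_ifs with h1 h2 h2
    · exact le_antisymm h1 h2
    · rfl
    · rfl
    · exact absurd (le_of_not_ge h1) h2
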